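/- Let $\mathbf{M}$ be a category with all small limits and colimits, let $(\mathrm{W},\mathrm{C},\mathrm{F})$ be a model structure on $\mathbf{M}$ (weak equivalences, cofibrations, fibrations), and let $\mathbf{M}^{\mathcal{G}}=(\mathrm{W}^{\mathcal{G}},\mathrm{C}^{\mathcal{G}},\mathrm{F}^{\mathcal{G}})$ be an $\ell\ell$-extension of it, that is, another model structure on the same category with $\mathrm{W}\subseteq\mathrm{W}^{\mathcal{G}}$, $\mathrm{C}^{\mathcal{G}}\subseteq\mathrm{C}$ and $\mathrm{F}^{\mathcal{G}}\subseteq\mathrm{F}$. An object is called fibrant (cofibrant) if it is so for $(\mathrm{W},\mathrm{C},\mathrm{F})$, and $\mathcal{G}$-fibrant ($\mathcal{G}$-cofibrant) if it is so for $\mathbf{M}^{\mathcal{G}}$. Suppose that the $\mathcal{G}$-cofibrant objects coincide with the cofibrant objects and that $\mathbf{M}$ is a simplicial category for which $\mathbf{M}^{\mathcal{G}}$ is a simplicial model category. Let $\mathcal{N}$ be a simplicial model category and let $T:\mathbf{M}\to\mathcal{N}$ be a simplicial functor which sends the maps in $\mathrm{W}$ between fibrant objects to weak equivalences. Then: 1.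 $T$ sends the maps in $\mathrm{W}^{\mathcal{G}}$ between $\mathcal{G}$-fibrant objects to weak equivalences. 2. The total right derived functor of $T$ with respect to $\mathbf{M}^{\mathcal{G}}$ exists; that is, the composite $\mathbf{M}\xrightarrow{T}\mathcal{N}\to\mathrm{Ho}(\mathcal{N})$ has a left Kan extension along the localization functor $\mathbf{M}\to\mathbf{M}[(\mathrm{W}^{\mathcal{G}})^{-1}]=\mathrm{Ho}(\mathbf{M}^{\mathcal{G}})$. -/

import Mathlib

open CategoryTheory CategoryTheory.Limits MonoidalCategory HomotopicalAlgebra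

universe v u u₁ u₂

/-! A category may carry several model structures, so model structures are passed as explicit
terms `𝓜 : ModelCategory C` below. -/

namespace ModelStr

variable {C : Type u} [Category.{v} C]

/-- The class of weak equivalences of a model structure. -/
def W (𝓜 : ModelCategory C) : MorphismProperty C :=
  @weakEquivalences C _ 𝓜.categoryWithWeakEquivalences

/-- The class of cofibrations of a model structure. -/
def Cof (𝓜 : ModelCategory C) : MorphismProperty C :=
  @cofibrations C _ 𝓜.categoryWithCofibrations

/-- The class of fibrations of a model structure. -/
def Fib (𝓜 : ModelCategory C) : MorphismProperty C :=
  @fibrations C _ 𝓜.categoryWithFibrations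

/-- An object is fibrant for `𝓜` if its map to the terminal object is a fibration. -/
def FibrantObj (𝓜 : ModelCategory C) (X : C) : Prop :=
  letI := 𝓜
  IsFibrant X

/-- An object is cofibrant for `𝓜` if the map from the initial object is a cofibration. -/
def CofibrantObj (𝓜 : ModelCategory C) (X : C) : Prop :=
  letI := 𝓜
  IsCofibrant X

/-- `𝓖` is an `ℓℓ`-extension of `𝓜`: a model structure on the same category with at least as
many weak equivalences, and with fewer (or the same) cofibrations and fibrations. -/
structure IsLLExtension (𝓜 𝓖 : ModelCategory C) : Prop where
  W_le : W 𝓜 ≤ W 𝓖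
  cof_le : Cof 𝓖 ≤ Cof 𝓜
  fib_le : Fib 𝓖 ≤ Fib 𝓜

end ModelStr

namespace SimplicialModel

open SimplicialCategory

section

variable {C : Type u} [Category.{v} C] [SimplicialCategory C]

/-- The morphism `Map(P, Y) ⟶ Map(K, Map(X, Y))` of simplicial sets
determined by `η : K ⟶ Map(X, P)`. -/
noncomputable def tensorComparison {K : SSet.{v}} {X P : C} (η : K ⟶ sHom X P) (Y : C) :
    sHom P Y ⟶ (ihom K).obj (sHom X Y) :=
  MonoidalClosed.curry (η ▷ sHom P Y ≫ sHomComp X P Y)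

/-- `η : K ⟶ Map(X, P)` exhibits `P` as the tensor `X ⊗ K`:
the induced maps `Map(P, Y) ⟶ Map(K, Map(X, Y))` are isomorphisms of simplicial sets. -/
def IsTensor {K : SSet.{v}} {X P : C} (η : K ⟶ sHom X P) : Prop :=
  ∀ Y : C, IsIso (tensorComparison η Y)

/-- The morphism `Map(X, Q) ⟶ Map(K, Map(X, Y))` of simplicial sets
determined by `ε : K ⟶ Map(Q, Y)`. -/
noncomputable def cotensorComparison {K : SSet.{v}} {Y Q : C} (ε : K ⟶ sHom Q Y) (X : C) :
    sHom X Q ⟶ (ihom K).obj (sHom X Y) :=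
  MonoidalClosed.curry ((β_ K (sHom X Q)).hom ≫ sHom X Q ◁ ε ≫ sHomComp X Q Y)

/-- `ε : K ⟶ Map(Q, Y)` exhibits `Q` as the cotensor `Y ^ K`:
the induced maps `Map(X, Q) ⟶ Map(K, Map(X, Y))` are isomorphisms of simplicial sets. -/
def IsCotensor {K : SSet.{v}} {Y Q : C} (ε : K ⟶ sHom Q Y) : Prop :=
  ∀ X : C, IsIso (cotensorComparison ε X)

/-- The morphism `Map(B, X) ⟶ Map(A, X) ×_{Map(A, Y)} Map(B, Y)` of simplicial sets
determined by `i : A ⟶ B` and `p : X ⟶ Y`. -/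
noncomputable def pullbackHom {A B X Y : C} (i : A ⟶ B) (p : X ⟶ Y) :
    sHom B X ⟶ pullback (eHomWhiskerLeft SSet.{v} A p) (eHomWhiskerRight SSet.{v} i Y) :=
  pullback.lift (eHomWhiskerRight SSet.{v} i X) (eHomWhiskerLeft SSet.{v} B p)
    (eHom_whisker_exchange SSet.{v} i p).symm

/-- A model structure on a simplicial category makes it a simplicial model category if all
tensors and cotensors with simplicial sets exist and the pullback-hom of a cofibration
and a fibration is a (Kan) fibration, which is moreover trivial when one of the two maps is a weak
equivalence. Here `SSet.modelCategoryQuillen.J` is the family of horn inclusions and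
`SSet.modelCategoryQuillen.I` is the family of boundary inclusions, so that `J.rlp` is the class
of Kan fibrations and `I.rlp` is the class of trivial fibrations of simplicial sets. -/
structure IsSimplicialModel (𝓜 : ModelCategory C) : Prop where
  exists_tensor (X : C) (K : SSet.{v}) : ∃ (P : C) (η : K ⟶ sHom X P), IsTensor η
  exists_cotensor (Y : C) (K : SSet.{v}) : ∃ (Q : C) (ε : K ⟶ sHom Q Y), IsCotensor ε
  fibration {A B X Y : C} (i : A ⟶ B) (p : X ⟶ Y) (hi : ModelStr.Cof 𝓜 i)
    (hp : ModelStr.Fib 𝓜 p) : SSet.modelCategoryQuillen.J.rlp (pullbackHom i p)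
  trivialFibration {A B X Y : C} (i : A ⟶ B) (p : X ⟶ Y) (hi : ModelStr.Cof 𝓜 i)
    (hp : ModelStr.Fib 𝓜 p) (h : ModelStr.W 𝓜 i ∨ ModelStr.W 𝓜 p) :
    SSet.modelCategoryQuillen.I.rlp (pullbackHom i p)

end

/-- A simplicial functor: a functor together with morphisms
`Map(X, Y) ⟶ Map(T X, T Y)` of simplicial sets which are compatible with identities and
compositions and which give back the functor on `0`-simplices. -/
structure SimplicialFunctor (C : Type u₁) [Category.{v} C] [SimplicialCategory C]
    (D : Type u₂) [Category.{v} D] [SimplicialCategory D] extends C ⥤ D where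
  sMap (X Y : C) : sHom X Y ⟶ sHom (obj X) (obj Y)
  sMap_id (X : C) : eId SSet.{v} X ≫ sMap X X = eId SSet.{v} (obj X)
  sMap_comp (X Y Z : C) :
    sHomComp X Y Z ≫ sMap X Z = (sMap X Y ⊗ₘ sMap Y Z) ≫ sHomComp (obj X) (obj Y) (obj Z)
  homEquiv_sMap {X Y : C} (f : X ⟶ Y) :
    eHomEquiv SSet.{v} f ≫ sMap X Y = eHomEquiv SSet.{v} (map f)

end SimplicialModel

/-! Let f be a 𝓖-equivalence between 𝓖-fibrant objects. Take cofibrant resolutions of its ends in 𝓜,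
not in 𝓖: they are trivial fibrations of 𝓜, hence 𝓖-fibrations (`IsLLExtension.fib_of_fib_of_W`), so
the resolved objects are 𝓖-fibrant, and 𝓖-cofibrant because cofibrant objects coincide. By
hypothesis `T` sends the resolutions to weak equivalences, so two-out-of-three reduces the claim to
a map between 𝓖-bifibrant objects.

There `SimplicialFunctor.weakEquivalence_map` applies: the map is a trivial cofibration followed by
a trivial fibration, both given by simplicial deformation retractions, which `T` preserves and which
consist of weak equivalences in any simplicial model category. The derived functor then exists
because `T` inverts 𝓖-equivalences between 𝓖-fibrant objects. -/

open Simplicial CartesianMonoidalCategory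

/-! ### Lifting points and edges in simplicial sets. -/

namespace SSet

/-- Two points of a simplicial set define a morphism from `∂Δ[1]`. -/
lemma boundary.exists_desc_one {S : SSet.{v}} (x₀ x₁ : Δ[0] ⟶ S) :
    ∃ φ : (∂Δ[1] : SSet.{v}) ⟶ S, boundary.ι 0 ≫ φ = x₀ ∧ boundary.ι 1 ≫ φ = x₁ := by
  -- `∂Δ[1]` is the union of two disjoint vertices, hence a pushout over the empty subcomplex.
  have sq : Subcomplex.BicartSq.{v} ⊥ (stdSimplex.face {(0 : Fin 2)}ᶜ)
      (stdSimplex.face {(1 : Fin 2)}ᶜ) ∂Δ[1] :=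
    { sup_eq := by
        rw [boundary_eq_iSup]
        apply le_antisymm
        · exact sup_le (le_iSup (fun i : Fin 2 ↦ stdSimplex.face {i}ᶜ) 0)
            (le_iSup (fun i : Fin 2 ↦ stdSimplex.face {i}ᶜ) 1)
        · refine iSup_le fun i ↦ ?_
          fin_cases i
          · exact le_sup_left
          · exact le_sup_right
      inf_eq := by
        rw [stdSimplex.face_inter_face]
        have : ({0}ᶜ ⊓ {1}ᶜ : Finset (Fin 2)) = ∅ := by decide
        rw [this]
        simp }
  refine ⟨sq.isPushout.desc ((stdSimplex.faceSingletonComplIso 0).inv ≫ x₀)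
    ((stdSimplex.faceSingletonComplIso 1).inv ≫ x₁) ?_, ?_, ?_⟩
  · ext n ⟨x, hx⟩
    simp at hx
  · have : boundary.ι (0 : Fin 2) = (stdSimplex.faceSingletonComplIso 0).hom ≫
        Subcomplex.homOfLE sq.le₂₄ := rfl
    rw [this, Category.assoc, sq.isPushout.inl_desc]
    simp
  · have : boundary.ι (1 : Fin 2) = (stdSimplex.faceSingletonComplIso 1).hom ≫
        Subcomplex.homOfLE sq.le₃₄ := rfl
    rw [this, Category.assoc, sq.isPushout.inr_desc]
    simp

/-- Edges lift along trivial fibrations, with prescribed endpoints. -/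
lemma exists_lift_edge_of_rlp_I {X Y : SSet.{v}} {p : X ⟶ Y} (hp : modelCategoryQuillen.I.rlp p)
    (x₀ x₁ : Δ[0] ⟶ X) (b : Δ[1] ⟶ Y) (h₀ : x₀ ≫ p = stdSimplex.δ 0 ≫ b)
    (h₁ : x₁ ≫ p = stdSimplex.δ 1 ≫ b) :
    ∃ φ : Δ[1] ⟶ X, stdSimplex.δ 0 ≫ φ = x₀ ∧ stdSimplex.δ 1 ≫ φ = x₁ ∧ φ ≫ p = b := by
  obtain ⟨u, hu₀, hu₁⟩ := boundary.exists_desc_one x₀ x₁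
  have sq : CommSq u ∂Δ[1].ι p b := ⟨by
    apply boundary.hom_ext
    intro j
    fin_cases j
    · simpa [reassoc_of% hu₀] using h₀
    · simpa [reassoc_of% hu₁] using h₁⟩
  have := hp _ (modelCategoryQuillen.boundary_ι_mem_I 1)
  refine ⟨sq.lift, ?_, ?_, by simp⟩
  · rw [← hu₀, ← boundary.ι_ι, Category.assoc, sq.fac_left]
  · rw [← hu₁, ← boundary.ι_ι, Category.assoc, sq.fac_left]

/-- Edges lift along Kan fibrations, with one prescribed endpoint. -/
lemma exists_lift_edge_of_rlp_J {X Y : SSet.{v}} {p : X ⟶ Y} (hp : modelCategoryQuillen.J.rlp p)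
    (j : Fin 2) (x : Δ[0] ⟶ X) (b : Δ[1] ⟶ Y) (h : x ≫ p = stdSimplex.δ j ≫ b) :
    ∃ φ : Δ[1] ⟶ X, stdSimplex.δ j ≫ φ = x ∧ φ ≫ p = b := by
  open scoped modelCategoryQuillen in
  have : Fibration p := ⟨hp⟩
  -- The image of `δ j` is the vertex `j.rev`, which is the whole horn at `j.rev`; a single face has
  -- no compatibility condition.
  have hc : horn.IsCompatible (X := X) (n := 0) (i := j.rev) (fun _ _ ↦ x) := trivial
  have hj : ∀ i : Fin 2, i ≠ i.rev := by decide
  have hj' : ∀ i k : Fin 2, k ≠ i.rev → k = i := by decide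
  obtain ⟨φ, h₁, h₂⟩ := hc.exists_lift p b (fun k hk ↦ by rw [hj' j k hk, h])
  exact ⟨φ, h₁ j (hj j), h₂⟩

end SSet

/-! ### Constant maps, tensors and simplicial homotopies. -/

namespace SimplicialModel

open SimplicialCategory SSet

section

variable {C : Type u} [Category.{v} C] [SimplicialCategory C]

/-- The morphism `K ⟶ Map(X, Y)` which is constant at `f : X ⟶ Y`. -/
noncomputable def constHom (K : SSet.{v}) {X Y : C} (f : X ⟶ Y) : K ⟶ sHom X Y :=
  toUnit K ≫ eHomEquiv SSet.{v} f

@[simp]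
lemma comp_constHom {K L : SSet.{v}} (k : K ⟶ L) {X Y : C} (f : X ⟶ Y) :
    k ≫ constHom L f = constHom K f := by
  simp [constHom]

lemma eHomEquiv_comp_eHomWhiskerLeft {X Y Z : C} (f : X ⟶ Y) (g : Y ⟶ Z) :
    eHomEquiv SSet.{v} f ≫ eHomWhiskerLeft SSet.{v} X g = eHomEquiv SSet.{v} (f ≫ g) := by
  rw [eHomEquiv_comp, eHomWhiskerLeft, MonoidalCategory.tensorHom_def, rightUnitor_inv_naturality_assoc,
    Category.assoc, unitors_inv_equal]

lemma eHomEquiv_comp_eHomWhiskerRight {X Y Z : C} (f : X ⟶ Y) (g : Y ⟶ Z) :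
    eHomEquiv SSet.{v} g ≫ eHomWhiskerRight SSet.{v} f Z = eHomEquiv SSet.{v} (f ≫ g) := by
  rw [eHomEquiv_comp, eHomWhiskerRight, tensorHom_def', leftUnitor_inv_naturality_assoc,
    Category.assoc]

@[simp]
lemma constHom_comp_eHomWhiskerLeft (K : SSet.{v}) {X Y Z : C} (f : X ⟶ Y) (g : Y ⟶ Z) :
    constHom K f ≫ eHomWhiskerLeft SSet.{v} X g = constHom K (f ≫ g) := by
  rw [constHom, Category.assoc, eHomEquiv_comp_eHomWhiskerLeft, constHom]

@[simp]
lemma constHom_comp_eHomWhiskerRight (K : SSet.{v}) {X Y Z : C} (f : X ⟶ Y) (g : Y ⟶ Z) :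
    constHom K g ≫ eHomWhiskerRight SSet.{v} f Z = constHom K (f ≫ g) := by
  rw [constHom, Category.assoc, eHomEquiv_comp_eHomWhiskerRight, constHom]

lemma constHom_point_bijective (X Y : C) :
    Function.Bijective (constHom (X := X) (Y := Y) Δ[0]) := by
  have : IsIso (toUnit (Δ[0] : SSet.{v})) :=
    isIso_of_isTerminal stdSimplex.isTerminalObj₀ isTerminalTensorUnit _
  exact ((eHomEquiv SSet.{v}).trans
    ((asIso (toUnit (Δ[0] : SSet.{v}))).symm.homFromEquiv)).bijective

/-- The universal property of the tensor on underlying morphisms, read off from 0-simplices of the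
comparison isomorphism. -/
lemma IsTensor.bijective {K : SSet.{v}} {X P : C} {η : K ⟶ sHom X P} (hη : IsTensor η) (Y : C) :
    Function.Bijective (fun φ : P ⟶ Y ↦ η ≫ eHomWhiskerLeft SSet.{v} X φ) := by
  have := hη Y
  have key (φ : P ⟶ Y) : eHomEquiv SSet.{v} φ ≫ tensorComparison η Y =
      MonoidalClosed.curry ((ρ_ K).hom ≫ η ≫ eHomWhiskerLeft SSet.{v} X φ) := by
    rw [tensorComparison, ← MonoidalClosed.curry_natural_left, eHomWhiskerLeft,
      whisker_exchange_assoc]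
    simp
  let e₁ : (P ⟶ Y) ≃ (𝟙_ SSet.{v} ⟶ (ihom K).obj (sHom X Y)) :=
    (eHomEquiv SSet.{v}).trans (asIso (tensorComparison η Y)).homToEquiv
  let e₂ : (K ⟶ sHom X Y) ≃ (𝟙_ SSet.{v} ⟶ (ihom K).obj (sHom X Y)) :=
    (ρ_ K).symm.homFromEquiv.trans ((ihom.adjunction K).homEquiv _ _)
  exact (Function.Bijective.of_comp_iff' e₂.bijective _).1
    (by convert e₁.bijective using 1; ext1 φ; exact (key φ).symm)

lemma IsCotensor.bijective {K : SSet.{v}} {Y Q : C} {ε : K ⟶ sHom Q Y} (hε : IsCotensor ε)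
    (X : C) :
    Function.Bijective (fun φ : X ⟶ Q ↦ ε ≫ eHomWhiskerRight SSet.{v} φ Y) := by
  have := hε X
  have key (φ : X ⟶ Q) : eHomEquiv SSet.{v} φ ≫ cotensorComparison ε X =
      MonoidalClosed.curry ((ρ_ K).hom ≫ ε ≫ eHomWhiskerRight SSet.{v} φ Y) := by
    rw [cotensorComparison, ← MonoidalClosed.curry_natural_left, eHomWhiskerRight,
      BraidedCategory.braiding_naturality_right_assoc, ← whisker_exchange_assoc]
    simp
  let e₁ : (X ⟶ Q) ≃ (𝟙_ SSet.{v} ⟶ (ihom K).obj (sHom X Y)) :=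
    (eHomEquiv SSet.{v}).trans (asIso (cotensorComparison ε X)).homToEquiv
  let e₂ : (K ⟶ sHom X Y) ≃ (𝟙_ SSet.{v} ⟶ (ihom K).obj (sHom X Y)) :=
    (ρ_ K).symm.homFromEquiv.trans ((ihom.adjunction K).homEquiv _ _)
  exact (Function.Bijective.of_comp_iff' e₂.bijective _).1
    (by convert e₁.bijective using 1; ext1 φ; exact (key φ).symm)

/-- Two morphisms `f` and `g` are simplicially homotopic if they are the endpoints of an edge of
`Map(X, Y)`. -/
def SimplicialHomotopic {X Y : C} (f g : X ⟶ Y) : Prop :=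
  ∃ h : Δ[1] ⟶ sHom X Y, stdSimplex.δ 0 ≫ h = constHom _ f ∧ stdSimplex.δ 1 ≫ h = constHom _ g

lemma SimplicialHomotopic.precomp {X' X Y : C} {f g : X ⟶ Y} (h : SimplicialHomotopic f g)
    (a : X' ⟶ X) : SimplicialHomotopic (a ≫ f) (a ≫ g) := by
  obtain ⟨h, h₀, h₁⟩ := h
  exact ⟨h ≫ eHomWhiskerRight SSet.{v} a Y, by simp [reassoc_of% h₀], by simp [reassoc_of% h₁]⟩

lemma pullbackHom_fst {A B X Y : C} (i : A ⟶ B) (p : X ⟶ Y) :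
    pullbackHom i p ≫ pullback.fst _ _ = eHomWhiskerRight SSet.{v} i X :=
  pullback.lift_fst _ _ _

lemma pullbackHom_snd {A B X Y : C} (i : A ⟶ B) (p : X ⟶ Y) :
    pullbackHom i p ≫ pullback.snd _ _ = eHomWhiskerLeft SSet.{v} B p :=
  pullback.lift_snd _ _ _

/-- If the pullback-hom of `i` and `p` is a trivial fibration, then two solutions of
the same lifting problem are simplicially homotopic. -/
lemma simplicialHomotopic_of_rlp_I {A B X Y : C} {i : A ⟶ B} {p : X ⟶ Y}
    (h : modelCategoryQuillen.I.rlp (pullbackHom i p)) {f g : B ⟶ X}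
    (hi : i ≫ f = i ≫ g) (hp : f ≫ p = g ≫ p) : SimplicialHomotopic f g := by
  obtain ⟨φ, h₀, h₁, -⟩ := exists_lift_edge_of_rlp_I h (constHom _ f) (constHom _ g)
    (pullback.lift (constHom _ (i ≫ f)) (constHom _ (f ≫ p)) (by simp))
    (by
      apply pullback.hom_ext
      · rw [Category.assoc, Category.assoc, pullbackHom_fst, pullback.lift_fst]
        simp
      · rw [Category.assoc, Category.assoc, pullbackHom_snd, pullback.lift_snd]
        simp)
    (by
      apply pullback.hom_ext
      · rw [Category.assoc, Category.assoc, pullbackHom_fst, pullback.lift_fst]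
        simp [hi]
      · rw [Category.assoc, Category.assoc, pullbackHom_snd, pullback.lift_snd]
        simp [hp])
  exact ⟨φ, h₀, h₁⟩

namespace SimplicialFunctor

variable {D : Type u₂} [Category.{v} D] [SimplicialCategory D]

lemma constHom_sMap (T : SimplicialFunctor C D) (K : SSet.{v}) {X Y : C} (f : X ⟶ Y) :
    constHom K f ≫ T.sMap X Y = constHom K (T.map f) := by
  rw [constHom, Category.assoc, T.homEquiv_sMap, constHom]

lemma map_simplicialHomotopic (T : SimplicialFunctor C D) {X Y : C} {f g : X ⟶ Y}
    (h : SimplicialHomotopic f g) : SimplicialHomotopic (T.map f) (T.map g) := by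
  obtain ⟨h, h₀, h₁⟩ := h
  exact ⟨h ≫ T.sMap X Y, by rw [reassoc_of% h₀, constHom_sMap],
    by rw [reassoc_of% h₁, constHom_sMap]⟩

end SimplicialFunctor

/-! ### Homotopy invariance of weak equivalences. -/

namespace IsSimplicialModel

variable [𝓜 : ModelCategory C] (h𝓜 : IsSimplicialModel 𝓜)

include h𝓜

/-- Such maps correspond to morphisms from `A` to the cotensor of `Y` by `K`. Thus the mapping space
out of the initial object adds no condition to lifting problems. -/
lemma hom_ext_of_isInitial {A Y : C} (hA : IsInitial A) {K : SSet.{v}} (f g : K ⟶ sHom A Y) :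
    f = g := by
  obtain ⟨Q, ε, hε⟩ := h𝓜.exists_cotensor Y K
  obtain ⟨a, rfl⟩ := (hε.bijective A).2 f
  obtain ⟨b, rfl⟩ := (hε.bijective A).2 g
  rw [hA.hom_ext a b]

/-- A fibration `p : E ⟶ B` induces a morphism `Map(X, E) ⟶ Map(X, B)` along which edges lift
when `X` is cofibrant. -/
lemma exists_lift_edge {X E B : C} [IsCofibrant X] (p : E ⟶ B) [Fibration p] (j : Fin 2)
    (u : X ⟶ E) (b : Δ[1] ⟶ sHom X B) (h : constHom _ (u ≫ p) = stdSimplex.δ j ≫ b) :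
    ∃ φ : Δ[1] ⟶ sHom X E, stdSimplex.δ j ≫ φ = constHom _ u ∧
      φ ≫ eHomWhiskerLeft SSet.{v} X p = b := by
  have hX : ModelStr.Cof 𝓜 (initial.to X) := mem_cofibrations _
  obtain ⟨φ, h₀, h₁⟩ := exists_lift_edge_of_rlp_J
    (h𝓜.fibration (initial.to X) p hX (mem_fibrations p)) j
    (constHom _ u) (pullback.lift (constHom _ (initial.to E)) b
      (h𝓜.hom_ext_of_isInitial initialIsInitial _ _))
    (by
      apply pullback.hom_ext
      · exact h𝓜.hom_ext_of_isInitial initialIsInitial _ _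
      · rw [Category.assoc, Category.assoc, pullbackHom_snd, pullback.lift_snd,
          constHom_comp_eHomWhiskerLeft, h])
  exact ⟨φ, h₀, by rw [← pullbackHom_snd (initial.to X), reassoc_of% h₁, pullback.lift_snd]⟩

/-- The two inclusions of a cofibrant object `X` in `X ⊗ Δ[1]` are weak equivalences. -/
lemma weakEquivalence_of_isTensor {X P : C} [IsCofibrant X] {η : Δ[1] ⟶ sHom X P}
    (hη : IsTensor η) (j : Fin 2) {d : X ⟶ P} (hd : stdSimplex.δ j ≫ η = constHom _ d) :
    WeakEquivalence d := by
  have hd' : trivialCofibrations C d := by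
    -- A square from `d` to a fibration is, by adjunction, an edge of `Map(X, B)` with a lift of one
    -- endpoint, so `exists_lift_edge` solves it.
    rw [← fibrations_llp]
    intro E B p hp
    have : Fibration p := ⟨hp⟩
    refine ⟨fun {u v} sq ↦ ?_⟩
    obtain ⟨ℓ, hℓ₁, hℓ₂⟩ := h𝓜.exists_lift_edge p j u (η ≫ eHomWhiskerLeft SSet.{v} X v)
      (by rw [reassoc_of% hd, constHom_comp_eHomWhiskerLeft, sq.w])
    obtain ⟨φ, hφ⟩ := (hη.bijective E).2 ℓ
    dsimp at hφ
    exact ⟨⟨{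
      l := φ
      fac_left := (constHom_point_bijective X E).1 (by
        rw [← constHom_comp_eHomWhiskerLeft, ← hd, Category.assoc, hφ, hℓ₁])
      fac_right := (hη.bijective B).1 (by
        dsimp
        rw [eHomWhiskerLeft_comp, reassoc_of% hφ, hℓ₂]) }⟩⟩
  exact ⟨hd'.2⟩

/-- The homotopy is a morphism φ out of the tensor of `X` with `Δ[1]`, whose two end inclusions are
weak equivalences; two-out-of-three passes from `f` to φ to `g`. -/
lemma weakEquivalence_of_simplicialHomotopic_of_isCofibrant {X Y : C} [IsCofibrant X]
    {f g : X ⟶ Y} (h : SimplicialHomotopic f g) [WeakEquivalence f] : WeakEquivalence g := by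
  obtain ⟨h, h₀, h₁⟩ := h
  obtain ⟨P, η, hη⟩ := h𝓜.exists_tensor X Δ[1]
  obtain ⟨d₀, hd₀⟩ := (constHom_point_bijective X P).2 (stdSimplex.δ 0 ≫ η)
  obtain ⟨d₁, hd₁⟩ := (constHom_point_bijective X P).2 (stdSimplex.δ 1 ≫ η)
  obtain ⟨φ, hφ⟩ := (hη.bijective Y).2 h
  dsimp at hφ
  have := h𝓜.weakEquivalence_of_isTensor hη 0 hd₀.symm
  have := h𝓜.weakEquivalence_of_isTensor hη 1 hd₁.symm
  have fac₀ : d₀ ≫ φ = f := (constHom_point_bijective X Y).1 (by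
    rw [← constHom_comp_eHomWhiskerLeft, hd₀, Category.assoc, hφ, h₀])
  have fac₁ : d₁ ≫ φ = g := (constHom_point_bijective X Y).1 (by
    rw [← constHom_comp_eHomWhiskerLeft, hd₁, Category.assoc, hφ, h₁])
  have : WeakEquivalence φ := weakEquivalence_of_precomp_of_fac fac₀
  rw [← fac₁]
  infer_instance

/-- In a simplicial model category, a morphism which is simplicially homotopic to a
weak equivalence is a weak equivalence. -/
lemma weakEquivalence_of_simplicialHomotopic {X Y : C}
    {f g : X ⟶ Y} (h : SimplicialHomotopic f g) [WeakEquivalence f] : WeakEquivalence g := by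
  have d := MorphismProperty.factorizationData (cofibrations C) (trivialFibrations C)
    (initial.to X)
  obtain ⟨_, _⟩ := (mem_trivialFibrations_iff d.p).1 d.hp
  have : Cofibration d.i := ⟨d.hi⟩
  have : IsCofibrant d.Z := (isCofibrant_iff_of_isInitial d.i initialIsInitial).2 this
  have := h𝓜.weakEquivalence_of_simplicialHomotopic_of_isCofibrant (h.precomp d.p)
  exact weakEquivalence_of_precomp d.p g

/-- In a simplicial model category, the inclusion of a simplicial deformation retract is
a weak equivalence. -/
lemma weakEquivalence_of_deformationRetract {X Y : C} {i : X ⟶ Y} {r : Y ⟶ X}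
    (hir : i ≫ r = 𝟙 X) (h : SimplicialHomotopic (𝟙 Y) (r ≫ i)) :
    WeakEquivalence i := by
  have := h𝓜.weakEquivalence_of_simplicialHomotopic h
  -- `r ≫ i` is a weak equivalence, and `i` is a retract of it: `i` and `r` on sources, identities
  -- on targets.
  let e : RetractArrow i (r ≫ i) :=
    { i := Arrow.homMk i (𝟙 Y) (by simp [reassoc_of% hir])
      r := Arrow.homMk r (𝟙 Y) (by simp)
      retract := by ext <;> simp [hir] }
  rw [weakEquivalence_iff]
  exact MorphismProperty.of_retract e (mem_weakEquivalences _)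

end IsSimplicialModel

end

/-! ### Simplicial functors on bifibrant objects. -/

section

variable {C : Type u₁} [Category.{v} C] [SimplicialCategory C]
  [𝓜 : ModelCategory C] (h𝓜 : IsSimplicialModel 𝓜)
  {D : Type u₂} [Category.{v} D] [SimplicialCategory D]
  [𝓝 : ModelCategory D] (h𝓝 : IsSimplicialModel 𝓝) (T : SimplicialFunctor C D)

include h𝓜 h𝓝

/-- Fibrancy of `A` gives a retraction r of `i`; fibrancy of `B` gives a homotopy from the identity
to `r ≫ i`, since both agree after `i`. `T` preserves these data. -/
lemma SimplicialFunctor.weakEquivalence_map_of_cofibration {A B : C} (i : A ⟶ B)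
    [Cofibration i] [WeakEquivalence i] [IsFibrant A] [IsFibrant B] :
    WeakEquivalence (T.map i) := by
  have sq : CommSq (𝟙 A) i (terminal.from A) (terminal.from B) := ⟨by simp⟩
  refine h𝓝.weakEquivalence_of_deformationRetract (r := T.map sq.lift)
    (by rw [← T.map_comp, sq.fac_left, T.map_id]) ?_
  rw [← T.map_comp, ← T.map_id]
  exact T.map_simplicialHomotopic (simplicialHomotopic_of_rlp_I
    (h𝓜.trivialFibration i (terminal.from B) (mem_cofibrations i) (mem_fibrations _)
      (Or.inl (mem_weakEquivalences i))) (by simp) (by simp))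

/-- Dually, `p` has a section whose image under `T` is the inclusion of a deformation retract. -/
lemma SimplicialFunctor.weakEquivalence_map_of_fibration {X Y : C} (p : X ⟶ Y)
    [Fibration p] [WeakEquivalence p] [IsCofibrant X] [IsCofibrant Y] :
    WeakEquivalence (T.map p) := by
  have sq : CommSq (initial.to X) (initial.to Y) p (𝟙 Y) := ⟨by simp⟩
  have hs : T.map sq.lift ≫ T.map p = 𝟙 _ := by rw [← T.map_comp, sq.fac_right, T.map_id]
  have : WeakEquivalence (T.map sq.lift) := by
    refine h𝓝.weakEquivalence_of_deformationRetract hs ?_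
    rw [← T.map_comp, ← T.map_id]
    exact T.map_simplicialHomotopic (simplicialHomotopic_of_rlp_I
      (h𝓜.trivialFibration (initial.to X) p (mem_cofibrations _) (mem_fibrations p)
        (Or.inr (mem_weakEquivalences p))) (by simp) (by simp))
  exact weakEquivalence_of_precomp_of_fac hs

/-- Simplicial functors between simplicial model categories preserve weak equivalences between
bifibrant objects. -/
lemma SimplicialFunctor.weakEquivalence_map {X Y : C} (f : X ⟶ Y) [WeakEquivalence f]
    [IsCofibrant X] [IsFibrant X] [IsCofibrant Y] [IsFibrant Y] :
    WeakEquivalence (T.map f) := by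
  have d := MorphismProperty.factorizationData (cofibrations C) (trivialFibrations C) f
  obtain ⟨_, _⟩ := (mem_trivialFibrations_iff d.p).1 d.hp
  have : Cofibration d.i := ⟨d.hi⟩
  have : WeakEquivalence d.i := weakEquivalence_of_postcomp_of_fac d.fac
  have : IsCofibrant d.Z := isCofibrant_of_cofibration d.i
  have : IsFibrant d.Z := isFibrant_of_fibration d.p
  have := T.weakEquivalence_map_of_cofibration h𝓜 h𝓝 d.i
  have := T.weakEquivalence_map_of_fibration h𝓜 h𝓝 d.p
  rw [← d.fac, T.map_comp]
  infer_instance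

end

end SimplicialModel

/-! ### Resolutions and comparison of the two model structures. -/

namespace ModelStr

variable {C : Type u} [Category.{v} C]

/-- Every object has a cofibrant resolution. -/
lemma exists_cofibrant_resolution (𝓜 : ModelCategory C) (X : C) :
    ∃ (X' : C) (p : X' ⟶ X), CofibrantObj 𝓜 X' ∧ Fib 𝓜 p ∧ W 𝓜 p := by
  have d := MorphismProperty.factorizationData (cofibrations C) (trivialFibrations C)
    (initial.to X)
  have : Cofibration d.i := ⟨d.hi⟩
  exact ⟨d.Z, d.p, (isCofibrant_iff_of_isInitial d.i initialIsInitial).2 this, d.hp⟩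

lemma fibrantObj_of_fib (𝓜 : ModelCategory C) {X Y : C} (p : X ⟶ Y) (hp : Fib 𝓜 p)
    (hY : FibrantObj 𝓜 Y) : FibrantObj 𝓜 X := by
  have : Fibration p := ⟨hp⟩
  have : IsFibrant Y := hY
  exact isFibrant_of_fibration p

lemma exists_lift_of_cofibrantObj (𝓜 : ModelCategory C) {A X Y : C} (hA : CofibrantObj 𝓜 A)
    (p : X ⟶ Y) (hp : Fib 𝓜 p) (hp' : W 𝓜 p) (f : A ⟶ Y) : ∃ g : A ⟶ X, g ≫ p = f := by
  have : Fibration p := ⟨hp⟩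
  have : WeakEquivalence p := ⟨hp'⟩
  have : IsCofibrant A := hA
  have sq : CommSq (initial.to X) (initial.to A) p f := ⟨by simp⟩
  exact ⟨sq.lift, sq.fac_right⟩

lemma rlp_cof (𝓜 : ModelCategory C) : (Cof 𝓜).rlp = Fib 𝓜 ⊓ W 𝓜 :=
  cofibrations_rlp C

variable {𝓜 𝓖 : ModelCategory C}

/-- Fewer cofibrations means a weaker lifting condition, so trivial fibrations of 𝓜 remain so in 𝓖.
-/
lemma IsLLExtension.fib_of_fib_of_W (h : IsLLExtension 𝓜 𝓖) {X Y : C} (p : X ⟶ Y)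
    (hp : Fib 𝓜 p) (hp' : W 𝓜 p) : Fib 𝓖 p := by
  have : (Cof 𝓖).rlp p := MorphismProperty.antitone_rlp h.cof_le _ (by
    rw [rlp_cof]
    exact ⟨hp, hp'⟩)
  rw [rlp_cof] at this
  exact this.1

lemma IsLLExtension.fibrantObj (h : IsLLExtension 𝓜 𝓖) {X : C} (hX : FibrantObj 𝓖 X) :
    FibrantObj 𝓜 X := by
  have hX' : Fib 𝓖 (terminal.from X) := hX.mem
  exact @Fibration.mk _ _ _ _ _ 𝓜.categoryWithFibrations (h.fib_le _ hX')

end ModelStr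

theorem proposition2p3 {M : Type u₁} [Category.{v} M] [HasLimits M] [HasColimits M]
    (𝓜 𝓖 : ModelCategory M) (hext : ModelStr.IsLLExtension 𝓜 𝓖)
    (hcof : ∀ X : M, ModelStr.CofibrantObj 𝓖 X ↔ ModelStr.CofibrantObj 𝓜 X)
    [SimplicialCategory M] (hG : SimplicialModel.IsSimplicialModel 𝓖)
    {N : Type u₂} [Category.{v} N] (𝓝 : ModelCategory N)
    [SimplicialCategory N] (hN : SimplicialModel.IsSimplicialModel 𝓝)
    (T : SimplicialModel.SimplicialFunctor M N)
    (hT : ∀ ⦃X Y : M⦄ (f : X ⟶ Y), ModelStr.W 𝓜 f → ModelStr.FibrantObj 𝓜 X →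
      ModelStr.FibrantObj 𝓜 Y → ModelStr.W 𝓝 (T.map f)) :
    (∀ ⦃X Y : M⦄ (f : X ⟶ Y), ModelStr.W 𝓖 f → ModelStr.FibrantObj 𝓖 X →
      ModelStr.FibrantObj 𝓖 Y → ModelStr.W 𝓝 (T.map f)) ∧
    (T.toFunctor ⋙ (ModelStr.W 𝓝).Q).HasRightDerivedFunctor (ModelStr.W 𝓖) := by
  have key : ∀ ⦃X Y : M⦄ (f : X ⟶ Y), ModelStr.W 𝓖 f → ModelStr.FibrantObj 𝓖 X →
      ModelStr.FibrantObj 𝓖 Y → ModelStr.W 𝓝 (T.map f) := by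
    intro X Y f hf hX hY
    obtain ⟨X', p, hX', hp, hp'⟩ := ModelStr.exists_cofibrant_resolution 𝓜 X
    obtain ⟨Y', q, hY', hq, hq'⟩ := ModelStr.exists_cofibrant_resolution 𝓜 Y
    obtain ⟨f', hf'⟩ := ModelStr.exists_lift_of_cofibrantObj 𝓜 hX' q hq hq' (p ≫ f)
    have hX'' := ModelStr.fibrantObj_of_fib 𝓖 p (hext.fib_of_fib_of_W p hp hp') hX
    have hY'' := ModelStr.fibrantObj_of_fib 𝓖 q (hext.fib_of_fib_of_W q hq hq') hY
    have hTp := hT p hp' (hext.fibrantObj hX'') (hext.fibrantObj hX)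
    have hTq := hT q hq' (hext.fibrantObj hY'') (hext.fibrantObj hY)
    have hf'' : ModelStr.W 𝓖 f' := by
      have : WeakEquivalence f := ⟨hf⟩
      have : WeakEquivalence p := ⟨hext.W_le _ hp'⟩
      have : WeakEquivalence q := ⟨hext.W_le _ hq'⟩
      exact (weakEquivalence_of_postcomp_of_fac hf').mem
    have hTf' : ModelStr.W 𝓝 (T.map f') := by
      have : WeakEquivalence f' := ⟨hf''⟩
      have : IsCofibrant X' := (hcof X').2 hX'
      have : IsCofibrant Y' := (hcof Y').2 hY'
      have : IsFibrant X' := hX''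
      have : IsFibrant Y' := hY''
      exact (T.weakEquivalence_map hG hN f').mem
    have : WeakEquivalence (T.map f') := ⟨hTf'⟩
    have : WeakEquivalence (T.map p) := ⟨hTp⟩
    have : WeakEquivalence (T.map q) := ⟨hTq⟩
    have fac : T.map p ≫ T.map f = T.map f' ≫ T.map q := by
      rw [← T.map_comp, ← T.map_comp, hf']
    exact (weakEquivalence_of_precomp_of_fac fac).mem
  refine ⟨key, ?_⟩
  -- Fibrant objects are those of 𝓖 here; they compute right derived functors of any functor
  -- inverting weak equivalences between them.
  have h : (FibrantObject.localizerMorphism M).Derives (T.toFunctor ⋙ (ModelStr.W 𝓝).Q) :=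
    fun X Y f hf ↦ Localization.inverts (ModelStr.W 𝓝).Q (ModelStr.W 𝓝) _
      (key f.hom hf X.property Y.property)
  have : (T.toFunctor ⋙ (ModelStr.W 𝓝).Q).HasPointwiseRightDerivedFunctor (ModelStr.W 𝓖) :=
    h.hasPointwiseRightDerivedFunctor
  exact Functor.hasRightDerivedFunctor_of_hasPointwiseRightDerivedFunctor _ _
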